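/- Let $p$ be a natural number, $u \subseteq \{1,\dots,p\}$ and $\overline u$ its complement. Let $(Y,X)$ be a random element of $\mathbb R \times \mathbb R^p$ with $\mathbb E[Y^2] < \infty$, and let $(Y_1,X_1),(Y_2,X_2),\dots$ be independent copies of $(Y,X)$. For $x \in \mathbb R^p$ and $v \subseteq \{1,\dots,p\}$ write $x^{(v)} = (x_j)_{j \in v}$, let $\leq$ and $\wedge$ be the componentwise order and minimum, and let $a^{(u)} \oplus b^{(\overline u)}$ be the vector of $\mathbb R^p$ with components $a_j$ if $j \in u$ and $b_j$ if $j \notin u$. For $k \in \{0,1,2\}$ let $$ m_k^{(v)}(x) = \mathbb E\big[ Y^k \mathbf 1\{X^{(v)} \leq x^{(v)}\}\big], \qquad \widehat m_k^{(v)}(x) = \frac 1n \sum_{i=1}^n Y_i^k \mathbf 1\{X_i^{(v)} \leq x^{(v)}\}, $$ (the condition $X^{(v)} \leq x^{(v)}$ being void if $v = \emptyset$), write $m_k, \widehat m_k$ for $v = \{1,\dots,p\}$, and put $\eta = (m_1, m_1^{(u)}, m_0^{(\overline u)})^\top$, $\widehat \eta = (\widehat m_1, \widehat m_1^{(u)},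 \widehat m_0^{(\overline u)})^\top$. Then there is a $3$-dimensional centered Gaussian field $G$ indexed by $\mathbb R^p$ with auto-covariance function $\operatorname{Cov}(G(x), G(x')) = \Omega(x,x')$, where $$ \Omega(x, x') = \begin{pmatrix} m_2(x \wedge x') & m_2 \big( (x \wedge x')^{(u)} \oplus x^{(\overline u)} \big) & m_1 \big( x^{(u)} \oplus (x \wedge x')^{(\overline u)} \big) \\ m_2 \big( (x \wedge x')^{(u)} \oplus x'^{(\overline u)} \big) & m_2^{(u)}(x \wedge x') & m_1 \big(x^{(u)} \oplus x'^{(\overline u)} \big) \\ m_1\big( x'^{(u)} \oplus (x \wedge x')^{(\overline u)} \big) & m_1 \big( x'^{(u)} \oplus x^{(\overline u)} \big) & m_0^{(\overline u)}(x \wedge x') \end{pmatrix} - \eta(x) \eta(x')^\top, \qquad x,x' \in \mathbb R^p, $$ and the process $\sqrt n (\widehat \eta - \eta)$ converges to $G$ in finite-dimensional distributions as $n \to \infty$: for all $K$ and $x_1,\dots,x_K \in \mathbb R^p$, the random vector $\big(\sqrt n(\widehat\eta - \eta)(x_k)\big)_{k \leq K}$ converges in distribution to $(G(x_k))_{k \leq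 K}$. -/

import Mathlib

open MeasureTheory ProbabilityTheory Filter

namespace MomentField

/-- The moment function `m_k^{(u)}(x) = E[Y ^ k 1{X^{(u)} ≤ x^{(u)}}]`. -/
noncomputable def moment {S : Type*} [MeasurableSpace S] (P : Measure S) {p : ℕ}
    (Y : S → ℝ) (X : S → Fin p → ℝ) (k : ℕ) (u : Finset (Fin p)) (x : Fin p → ℝ) : ℝ :=
  ∫ s, Y s ^ k * {s | u.restrict (X s) ≤ u.restrict x}.indicator 1 s ∂P

/-- The empirical counterpart of `moment`, based on the first `n` observations. -/
noncomputable def empMoment {S : Type*} {p : ℕ} (Y : ℕ → S → ℝ) (X : ℕ → S → Fin p → ℝ)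
    (n k : ℕ) (u : Finset (Fin p)) (x : Fin p → ℝ) (s : S) : ℝ :=
  (1 / (n : ℝ)) * ∑ i ∈ Finset.range n,
    Y i s ^ k * {s | u.restrict (X i s) ≤ u.restrict x}.indicator 1 s

/-- `η = (m_1, m_1^{(u)}, m_0^{(ū)})`. -/
noncomputable def eta {S : Type*} [MeasurableSpace S] (P : Measure S) {p : ℕ}
    (Y : S → ℝ) (X : S → Fin p → ℝ) (u : Finset (Fin p)) (x : Fin p → ℝ) : Fin 3 → ℝ :=
  ![moment P Y X 1 Finset.univ x, moment P Y X 1 u x, moment P Y X 0 uᶜ x]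

/-- The empirical version of `eta`. -/
noncomputable def empEta {S : Type*} {p : ℕ} (Y : ℕ → S → ℝ) (X : ℕ → S → Fin p → ℝ)
    (u : Finset (Fin p)) (n : ℕ) (x : Fin p → ℝ) (s : S) : Fin 3 → ℝ :=
  ![empMoment Y X n 1 Finset.univ x s, empMoment Y X n 1 u x s, empMoment Y X n 0 uᶜ x s]

/-- The vector `a^{(u)} ⊕ b^{(ū)}`: the coordinates of `a` in `u`, those of `b` outside `u`. -/
def glue {p : ℕ} (u : Finset (Fin p)) (a b : Fin p → ℝ) : Fin p → ℝ :=
  fun j => if j ∈ u then a j else b j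

/-- The auto-covariance function `Ω(x, x')`. -/
noncomputable def autoCov {S : Type*} [MeasurableSpace S] (P : Measure S) {p : ℕ}
    (Y : S → ℝ) (X : S → Fin p → ℝ) (u : Finset (Fin p)) (x x' : Fin p → ℝ) :
    Matrix (Fin 3) (Fin 3) ℝ :=
  !![moment P Y X 2 Finset.univ (x ⊓ x'),
      moment P Y X 2 Finset.univ (glue u (x ⊓ x') x),
      moment P Y X 1 Finset.univ (glue u x (x ⊓ x'));
    moment P Y X 2 Finset.univ (glue u (x ⊓ x') x'),
      moment P Y X 2 u (x ⊓ x'),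
      moment P Y X 1 Finset.univ (glue u x x');
    moment P Y X 1 Finset.univ (glue u x' (x ⊓ x')),
      moment P Y X 1 Finset.univ (glue u x' x),
      moment P Y X 0 uᶜ (x ⊓ x')]
  - Matrix.vecMulVec (eta P Y X u x) (eta P Y X u x')

/-- Convergence in finite-dimensional distributions of a sequence of processes `W n`, indexed by
`T`, to a process `G`: for all `t_1, …, t_K` in `T`, the vectors `(W n t_1, …, W n t_K)` converge
in distribution to `(G t_1, …, G t_K)`. -/
def TendstoInFDD {S S' T E : Type*} [MeasurableSpace S] [MeasurableSpace S']
    [TopologicalSpace E] [SecondCountableTopology E] [MeasurableSpace E] [BorelSpace E]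
    (W : ℕ → T → S → E) (G : T → S' → E)
    (P : Measure S) [IsProbabilityMeasure P] (P' : Measure S') [IsProbabilityMeasure P'] : Prop :=
  ∀ (K : ℕ) (t : Fin K → T),
    TendstoInDistribution (fun (n : ℕ) (s : S) (k : Fin K) => W n (t k) s) atTop
      (fun (s : S') (k : Fin K) => G (t k) s) (fun _ => P) P'

end MomentField

namespace MomentField

open scoped Topology RealInnerProductSpace

/-! ### The isonormal Gaussian process. -/

section Isonormal

/-! The components of `empEta` are empirical means of the functions `etaFun u x a`, which are square
integrable under the law `μ` of `(Y, X)`. The claim is thus a multivariate central limit theorem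
plus the existence of one Gaussian field carrying all the limits.

For the field, `exists_isonormal` embeds a Hilbert space isometrically into `L²` as centered
Gaussian variables, sending a Hilbert basis to independent standard normals. Evaluating it at
centered elements of `L²(μ)` (`exists_gaussian_family`) gives covariances `cov[f, g; μ]`. These are
the entries of `autoCov`, since a product of orthant indicators is again an orthant indicator
(`autoCov_eq_covariance`). Convergence follows from the scalar central limit theorem by Cramér-Wold.
-/

/-- Convergence in `L²` implies convergence in distribution. This extends the Gaussian law from the
span of a basis to its closure. -/
lemma continuous_charFun_map_Lp {Ω : Type*} [MeasurableSpace Ω] (P : Measure Ω)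
    [IsProbabilityMeasure P] (t : ℝ) :
    Continuous fun f : Lp ℝ 2 P => charFun (P.map f) t := by
  refine continuous_iff_seqContinuous.2 fun f g hfg => ?_
  have hd : TendstoInDistribution (fun n => (f n : Ω → ℝ)) atTop g (fun _ => P) P :=
    (tendstoInMeasure_of_tendsto_Lp hfg).tendstoInDistribution
      fun n => (Lp.aestronglyMeasurable _).aemeasurable
  exact ProbabilityMeasure.tendsto_iff_tendsto_charFun.1 hd.tendsto t

lemma charFun_map_of_hasGaussianLaw_Lp {Ω : Type*} [MeasurableSpace Ω] {P : Measure Ω}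
    [IsProbabilityMeasure P] (f : Lp ℝ 2 P) (hf : HasGaussianLaw f P) (h0 : ∫ ω, f ω ∂P = 0)
    (t : ℝ) :
    charFun (P.map f) t = Complex.exp (-(‖f‖ ^ 2 * t ^ 2 / 2 : ℝ)) := by
  have hvar : Var[f; P] = ‖f‖ ^ 2 := by
    rw [variance_of_integral_eq_zero hf.aemeasurable h0, ← real_inner_self_eq_norm_sq,
      L2.inner_def]
    simp [pow_two]
  rw [hf.map_eq_gaussianReal, charFun_gaussianReal, h0, hvar, Real.coe_toNNReal _ (sq_nonneg _)]
  push_cast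
  congr 1
  ring

/-- The isonormal Gaussian process over a real Hilbert space. -/
theorem exists_isonormal (H : Type) [NormedAddCommGroup H] [InnerProductSpace ℝ H]
    [CompleteSpace H] :
    ∃ (Ω : Type) (_ : MeasurableSpace Ω) (P : Measure Ω) (_ : IsProbabilityMeasure P)
      (W : H →ₗᵢ[ℝ] Lp ℝ 2 P),
      ∀ h, HasLaw (W h) (gaussianReal 0 (‖h‖ ^ 2).toNNReal) P := by
  classical
  obtain ⟨w, b, -⟩ := exists_hilbertBasis ℝ H
  let P : Measure (w → ℝ) := Measure.infinitePi fun _ => gaussianReal 0 1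
  have hlaw (i : w) : HasLaw (fun ω : w → ℝ => ω i) (gaussianReal 0 1) P :=
    (measurePreserving_eval_infinitePi (fun _ : w => gaussianReal 0 1) i).hasLaw
  have hG (i : w) : HasGaussianLaw (fun ω : w → ℝ => ω i) P := (hlaw i).hasGaussianLaw
  have hind : iIndepFun (fun (i : w) (ω : w → ℝ) => ω i) P :=
    iIndepFun_infinitePi (X := fun _ x => x) fun _ => measurable_id
  have hmean (i : w) : ∫ ω, ω i ∂P = 0 := by
    rw [(hlaw i).integral_eq, integral_id_gaussianReal]
  have hmem (i : w) : MemLp (fun ω : w → ℝ => ω i) 2 P := (hG i).memLp_two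
  let ξ (i : w) : Lp ℝ 2 P := (hmem i).toLp
  have hξ : Orthonormal ℝ ξ := by
    rw [orthonormal_iff_ite]
    intro i j
    have h1 : ⟪ξ i, ξ j⟫ = cov[fun ω : w → ℝ => ω i, fun ω => ω j; P] := by
      rw [covariance_eq_sub (hmem i) (hmem j), hmean, zero_mul, sub_zero, L2.inner_def]
      refine integral_congr_ae ?_
      filter_upwards [(hmem i).coeFn_toLp, (hmem j).coeFn_toLp] with ω h1 h2
      simp [ξ, h1, h2, mul_comm]
    rw [h1]
    split_ifs with hij
    · subst hij
      rw [covariance_self (hmem i).aestronglyMeasurable.aemeasurable, (hlaw i).variance_eq,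
        variance_id_gaussianReal]
      simp
    · exact (hind.indepFun hij).covariance_eq_zero (hmem i) (hmem j)
  let W : H →ₗᵢ[ℝ] Lp ℝ 2 P :=
    hξ.orthogonalFamily.linearIsometry.comp b.repr.toLinearIsometry
  have hW (i : w) : W (b i) = ξ i := by
    simp [W, b.repr_self, OrthogonalFamily.linearIsometry_apply_single]
  -- On the algebraic span, `W h` is a finite sum of independent Gaussians.
  have hspan : ∀ h ∈ (Submodule.span ℝ (Set.range b) : Set H), ∀ t : ℝ,
      charFun (P.map (W h)) t = Complex.exp (-(‖W h‖ ^ 2 * t ^ 2 / 2 : ℝ)) := by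
    intro h hh
    obtain ⟨c, rfl⟩ := Finsupp.mem_span_range_iff_exists_finsupp.1 hh
    have hae : (W (c.sum fun i a => a • b i) : (w → ℝ) → ℝ) =ᵐ[P]
        fun ω => ∑ i : c.support, c i * ω i := by
      have h1 : W (c.sum fun i a => a • b i) = ∑ i : c.support, c i • ξ i := by
        rw [Finsupp.sum, map_sum, ← Finset.sum_coe_sort]
        simp [hW]
      rw [h1]
      refine (Lp.coeFn_finsetSum _ _).trans ?_
      have h2 : ∀ᵐ ω ∂P, ∀ i : c.support, (c i • ξ i : Lp ℝ 2 P) ω = c i * ω i := by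
        refine ae_all_iff.2 fun i => ?_
        filter_upwards [Lp.coeFn_smul (c i) (ξ i), (hmem i).coeFn_toLp] with ω h1 h2
        rw [h1, Pi.smul_apply, h2, smul_eq_mul]
      filter_upwards [h2] with ω h2
      simp [h2]
    refine charFun_map_of_hasGaussianLaw_Lp _ (HasGaussianLaw.congr ?_ hae.symm) ?_
    · refine iIndepFun.hasGaussianLaw_fun_sum (fun i : c.support => (hG i).fun_smul (c i)) ?_
      exact (hind.precomp Subtype.val_injective).comp (fun (i : c.support) x => c i • x)
        fun i => measurable_const_smul _
    · rw [integral_congr_ae hae, integral_finsetSum]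
      · simp [integral_const_mul, hmean]
      · exact fun i _ => (hG i).integrable.const_mul _
  refine ⟨w → ℝ, inferInstance, P, inferInstance, W, fun h =>
    ⟨(Lp.aestronglyMeasurable _).aemeasurable, ?_⟩⟩
  have hmP : IsProbabilityMeasure (P.map (W h)) :=
    Measure.isProbabilityMeasure_map (Lp.aestronglyMeasurable _).aemeasurable
  refine Measure.ext_of_charFun (funext fun t => ?_)
  -- Both sides are continuous in `h` and agree on a dense subspace.
  have hcont : (fun h => charFun (P.map (W h)) t) =
      fun h => Complex.exp (-(‖W h‖ ^ 2 * t ^ 2 / 2 : ℝ)) := by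
    refine Continuous.ext_on (s := (Submodule.span ℝ (Set.range b) : Set H)) ?_ ?_ ?_ ?_
    · exact Submodule.dense_iff_topologicalClosure_eq_top.2 b.dense_span
    · exact (continuous_charFun_map_Lp P t).comp W.continuous
    · have := W.continuous
      fun_prop
    · exact fun h hh => hspan h hh t
  rw [congrFun hcont h, charFun_gaussianReal, Real.coe_toNNReal _ (sq_nonneg _), W.norm_map]
  push_cast
  congr 1
  ring

end Isonormal

end MomentField

namespace MomentField

open scoped Topology RealInnerProductSpace

/-! ### Gaussian families indexed by square integrable functions. -/

section GaussianFamily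

/-- A centered Gaussian family indexed by the square integrable functions, with the same
covariances as these functions. -/
theorem exists_gaussian_family {Z : Type} [MeasurableSpace Z] (μ : Measure Z)
    [IsProbabilityMeasure μ] :
    ∃ (Ω : Type) (_ : MeasurableSpace Ω) (P : Measure Ω) (_ : IsProbabilityMeasure P)
      (B : (Z → ℝ) → Ω → ℝ),
      (∀ f, MemLp (B f) 2 P) ∧
      (∀ f g, MemLp f 2 μ → MemLp g 2 μ → cov[B f, B g; P] = cov[f, g; μ]) ∧
      ∀ (κ : Type) [Fintype κ] (f : κ → Z → ℝ), (∀ k, MemLp (f k) 2 μ) → ∀ c : κ → ℝ,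
        HasLaw (fun ω => ∑ k, c k * B (f k) ω)
          (gaussianReal 0 Var[fun z => ∑ k, c k * f k z; μ].toNNReal) P := by
  classical
  obtain ⟨Ω, mΩ, P, hP, W, hW⟩ := exists_isonormal (Lp ℝ 2 μ)
  have hc {f : Z → ℝ} (hf : MemLp f 2 μ) : MemLp (fun z => f z - ∫ z, f z ∂μ) 2 μ :=
    hf.sub (memLp_const _)
  -- Centering turns inner products into covariances; the default `0` keeps every `B f` in `L²`.
  let B (f : Z → ℝ) : Ω → ℝ := if hf : MemLp f 2 μ then W (hc hf).toLp else 0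
  have hB {f : Z → ℝ} (hf : MemLp f 2 μ) : B f = W (hc hf).toLp := dif_pos hf
  have hmean (h : Lp ℝ 2 μ) : ∫ ω, W h ω ∂P = 0 := by
    rw [(hW h).integral_eq, integral_id_gaussianReal]
  have hinner {f g : Z → ℝ} (hf : MemLp f 2 μ) (hg : MemLp g 2 μ) :
      ⟪(hc hf).toLp, (hc hg).toLp⟫ = cov[f, g; μ] := by
    rw [L2.inner_def, covariance]
    refine integral_congr_ae ?_
    filter_upwards [(hc hf).coeFn_toLp, (hc hg).coeFn_toLp] with z h1 h2
    simp [h1, h2, mul_comm]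
  refine ⟨Ω, mΩ, P, hP, B, fun f => ?_, fun f g hf hg => ?_, fun κ _ f hf c => ?_⟩
  · by_cases hf : MemLp f 2 μ
    · rw [hB hf]
      exact Lp.memLp _
    · simp [B, hf]
  · rw [hB hf, hB hg, covariance_eq_sub (Lp.memLp _) (Lp.memLp _), hmean, zero_mul, sub_zero,
      ← hinner hf hg, ← W.inner_map_map, L2.inner_def]
    simp [mul_comm]
  · have hsum : MemLp (fun z => ∑ k, c k * f k z) 2 μ :=
      memLp_finsetSum _ fun k _ => (hf k).const_mul (c k)
    have heq : (hc hsum).toLp = ∑ k, c k • (hc (hf k)).toLp := by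
      refine Lp.ext ?_
      refine (hc hsum).coeFn_toLp.trans (.trans ?_ (Lp.coeFn_finsetSum _ _).symm)
      have h2 : ∀ᵐ z ∂μ, ∀ k, (c k • (hc (hf k)).toLp : Lp ℝ 2 μ) z =
          c k * (f k z - ∫ z, f k z ∂μ) := by
        refine ae_all_iff.2 fun k => ?_
        filter_upwards [Lp.coeFn_smul (c k) (hc (hf k)).toLp, (hc (hf k)).coeFn_toLp]
          with z h1 h2
        rw [h1, Pi.smul_apply, h2, smul_eq_mul]
      filter_upwards [h2] with z h2
      rw [integral_finsetSum _ fun k _ => ((hf k).integrable (by norm_num)).const_mul _]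
      simp [h2, integral_const_mul, mul_sub]
    have hnorm : ‖(hc hsum).toLp‖ ^ 2 = Var[fun z => ∑ k, c k * f k z; μ] := by
      rw [← real_inner_self_eq_norm_sq, hinner hsum hsum,
        covariance_self hsum.aestronglyMeasurable.aemeasurable]
    rw [← hnorm]
    refine (hW _).congr ?_
    rw [heq, map_sum]
    refine .trans ?_ (Lp.coeFn_finsetSum _ _).symm
    have h2 : ∀ᵐ ω ∂P, ∀ k, W (c k • (hc (hf k)).toLp) ω = c k * W (hc (hf k)).toLp ω := by
      refine ae_all_iff.2 fun k => ?_
      rw [map_smul]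
      filter_upwards [Lp.coeFn_smul (c k) (W (hc (hf k)).toLp)] with ω h1
      rw [h1, Pi.smul_apply, smul_eq_mul]
    filter_upwards [h2] with ω h2
    simp only [Finset.sum_apply, h2, hB (hf _)]

/-- Every linear functional on `κ → ι → ℝ` is a combination of coordinates. -/
lemma hasGaussianLaw_pi_of_forall_sum {Ω κ ι : Type*} [MeasurableSpace Ω] {P : Measure Ω}
    [Fintype κ] [Fintype ι] {X : Ω → κ → ι → ℝ} (hX : AEMeasurable X P)
    (h : ∀ c : κ × ι → ℝ, HasGaussianLaw (fun ω => ∑ k, c k * X ω k.1 k.2) P) :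
    HasGaussianLaw X P := by
  classical
  refine ⟨⟨fun L => ?_⟩⟩
  have hL : L ∘ X = fun ω => ∑ k : κ × ι,
      L (Pi.single k.1 (Pi.single k.2 1)) * X ω k.1 k.2 := by
    funext ω
    have hx : X ω = ∑ k : κ × ι,
        X ω k.1 k.2 • (Pi.single k.1 (Pi.single k.2 1) : κ → ι → ℝ) := by
      funext i a
      rw [Fintype.sum_prod_type]
      simp [Finset.sum_apply, Pi.single_apply, ite_apply]
    conv_lhs => rw [Function.comp_apply, hx, map_sum]
    simp [mul_comm]
  have hg : HasGaussianLaw (L ∘ X) P := hL ▸ h _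
  rw [AEMeasurable.map_map_of_aemeasurable (by fun_prop) hX, hg.map_eq_gaussianReal,
    integral_map hX (by fun_prop), variance_map (by fun_prop) hX]
  rfl

end GaussianFamily

/-! ### The Cramér-Wold device and the multivariate central limit theorem. -/

section CramerWold

lemma charFun_map_toLp_eq_charFun_map_sum {Ω κ : Type*} [MeasurableSpace Ω] {P : Measure Ω}
    [Fintype κ] {X : Ω → κ → ℝ} (hX : AEMeasurable X P) (t : EuclideanSpace ℝ κ) :
    charFun (P.map fun ω => WithLp.toLp 2 (X ω)) t =
      charFun (P.map fun ω => ∑ k, t k * X ω k) 1 := by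
  rw [charFun_apply, charFun_apply, integral_map (by fun_prop) (by fun_prop),
    integral_map (by fun_prop) (by fun_prop)]
  simp [PiLp.inner_apply]

/-- The **Cramér-Wold theorem**. -/
theorem tendstoInDistribution_pi_of_forall_sum {Ω Ω' κ : Type*} [MeasurableSpace Ω]
    [MeasurableSpace Ω'] {P : Measure Ω} [IsProbabilityMeasure P] {P' : Measure Ω'}
    [IsProbabilityMeasure P'] [Fintype κ] {X : ℕ → Ω → κ → ℝ} {Y : Ω' → κ → ℝ}
    (hX : ∀ n, AEMeasurable (X n) P) (hY : AEMeasurable Y P')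
    (h : ∀ c : κ → ℝ, TendstoInDistribution (fun n ω => ∑ k, c k * X n ω k) atTop
      (fun ω => ∑ k, c k * Y ω k) (fun _ => P) P') :
    TendstoInDistribution X atTop Y (fun _ => P) P' := by
  -- Characteristic functions need an inner product, hence the detour through Euclidean space.
  have hE : TendstoInDistribution (fun n ω => WithLp.toLp 2 (X n ω)) atTop
      (fun ω => WithLp.toLp 2 (Y ω)) (fun _ => P) P' := by
    refine ⟨fun n => by have := hX n; fun_prop, by fun_prop, ?_⟩
    refine ProbabilityMeasure.tendsto_iff_tendsto_charFun.2 fun t => ?_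
    have := ProbabilityMeasure.tendsto_iff_tendsto_charFun.1 (h t).tendsto 1
    simpa only [ProbabilityMeasure.coe_mk, charFun_map_toLp_eq_charFun_map_sum (hX _),
      charFun_map_toLp_eq_charFun_map_sum hY] using this
  exact hE.continuous_comp (g := WithLp.ofLp) (PiLp.continuous_ofLp 2 _)

/-- The multivariate **central limit theorem**, for functions of i.i.d. observations. -/
theorem tendstoInDistribution_pi_inv_sqrt_mul_sum_sub {S Ω Z κ : Type*} [MeasurableSpace S]
    [MeasurableSpace Ω] [MeasurableSpace Z] [Fintype κ] {P : Measure S} [IsProbabilityMeasure P]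
    {P' : Measure Ω} [IsProbabilityMeasure P'] {μ : Measure Z} [IsProbabilityMeasure μ]
    {ξ : ℕ → S → Z}
    (hindep : iIndepFun ξ P) (hlaw : ∀ i, HasLaw (ξ i) μ P) {f : κ → Z → ℝ}
    (hfm : ∀ k, Measurable (f k)) (hf : ∀ k, MemLp (f k) 2 μ) {G : Ω → κ → ℝ}
    (hGm : AEMeasurable G P')
    (hG : ∀ c : κ → ℝ, HasLaw (fun ω => ∑ k, c k * G ω k)
      (gaussianReal 0 Var[fun z => ∑ k, c k * f k z; μ].toNNReal) P') :
    TendstoInDistribution (fun (n : ℕ) s k =>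
        (√(n : ℝ))⁻¹ * (∑ i ∈ Finset.range n, f k (ξ i s) - n * ∫ z, f k z ∂μ))
      atTop G (fun _ => P) P' := by
  have hξm (i) : AEMeasurable (ξ i) P := (hlaw i).aemeasurable
  refine tendstoInDistribution_pi_of_forall_sum (fun n => ?_) hGm fun c => ?_
  · refine aemeasurable_pi_lambda _ fun k => ?_
    have (i : ℕ) : AEMeasurable (fun s => f k (ξ i s)) P := (hfm k).comp_aemeasurable (hξm i)
    fun_prop
  have hgm : Measurable fun z => ∑ k, c k * f k z := by fun_prop
  have hg : MemLp (fun z => ∑ k, c k * f k z) 2 μ :=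
    memLp_finsetSum _ fun k _ => (hf k).const_mul (c k)
  have hid (i) : IdentDistrib (ξ i) (ξ 0) P P :=
    ⟨hξm i, hξm 0, by rw [(hlaw i).map_eq, (hlaw 0).map_eq]⟩
  have hvar : Var[fun s => ∑ k, c k * f k (ξ 0 s); P] = Var[fun z => ∑ k, c k * f k z; μ] := by
    rw [← (hlaw 0).map_eq, variance_map hgm.aemeasurable (hξm 0)]
    rfl
  have hint : ∫ s, ∑ k, c k * f k (ξ 0 s) ∂P = ∑ k, c k * ∫ z, f k z ∂μ := by
    have := (hlaw 0).integral_comp hg.aestronglyMeasurable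
    rw [Function.comp_def] at this
    rw [this, integral_finsetSum _ fun k _ => ((hf k).integrable (by norm_num)).const_mul _]
    simp [integral_const_mul]
  have hmem : MemLp (fun s => ∑ k, c k * f k (ξ 0 s)) 2 P := by
    have := hg
    rw [← (hlaw 0).map_eq] at this
    exact this.comp_of_map (hξm 0)
  have hclt := tendstoInDistribution_inv_sqrt_mul_sum_sub
    (X := fun i s => ∑ k, c k * f k (ξ i s)) (hvar ▸ hG c) hmem
    (hindep.comp (fun _ z => ∑ k, c k * f k z) fun _ => hgm)
    (fun i => (hid i).comp hgm)
  convert! hclt using 3 with n s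
  rw [hint, Finset.sum_comm, Finset.mul_sum, ← Finset.sum_sub_distrib, Finset.mul_sum]
  refine Finset.sum_congr rfl fun k _ => ?_
  rw [← Finset.mul_sum]
  ring

end CramerWold

end MomentField

namespace MomentField

/-! ### Moments as integrals, and the covariance matrix. -/

section Features

variable {p : ℕ}

/-- The integrand `(y, x') ↦ y ^ k 1{x'^{(v)} ≤ x^{(v)}}` of the moment functions. -/
noncomputable def momentFun (k : ℕ) (v : Finset (Fin p)) (x : Fin p → ℝ) :
    ℝ × (Fin p → ℝ) → ℝ :=
  fun z => z.1 ^ k * {z : ℝ × (Fin p → ℝ) | v.restrict z.2 ≤ v.restrict x}.indicator 1 z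

lemma measurable_momentFun (k : ℕ) (v : Finset (Fin p)) (x : Fin p → ℝ) :
    Measurable (momentFun k v x) := by
  have : MeasurableSet {z : ℝ × (Fin p → ℝ) | v.restrict z.2 ≤ v.restrict x} :=
    measurableSet_le ((Finset.measurable_restrict v).comp measurable_snd) measurable_const
  exact (measurable_fst.pow_const k).mul (measurable_one.indicator this)

/-- The indicator is bounded by `1`, and only `k ≤ 1` is covered by a second moment of `Y`. -/
lemma memLp_momentFun {μ : Measure (ℝ × (Fin p → ℝ))} [IsProbabilityMeasure μ]
    (hμ : MemLp Prod.fst 2 μ) {k : ℕ} (hk : k ≤ 1) (v : Finset (Fin p)) (x : Fin p → ℝ) :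
    MemLp (momentFun k v x) 2 μ := by
  have hpow : MemLp (fun z : ℝ × (Fin p → ℝ) => z.1 ^ k) 2 μ := by
    interval_cases k
    · simpa using memLp_const (1 : ℝ)
    · simpa using hμ
  refine hpow.mono (measurable_momentFun k v x).aestronglyMeasurable (.of_forall fun z => ?_)
  rw [momentFun, norm_mul]
  refine mul_le_of_le_one_right (norm_nonneg _) ?_
  by_cases hz : z ∈ {z : ℝ × (Fin p → ℝ) | v.restrict z.2 ≤ v.restrict x} <;> simp [hz]

lemma moment_eq_integral_momentFun {S : Type*} [MeasurableSpace S] {P : Measure S} {Y : S → ℝ}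
    {X : S → Fin p → ℝ} (hYX : AEMeasurable (fun s => (Y s, X s)) P) (k : ℕ)
    (v : Finset (Fin p)) (x : Fin p → ℝ) :
    moment P Y X k v x = ∫ z, momentFun k v x z ∂(P.map fun s => (Y s, X s)) := by
  rw [integral_map hYX (measurable_momentFun k v x).aestronglyMeasurable]
  rfl

/-- The hypothesis says that two orthants intersect in a third; their indicators multiply
accordingly. -/
lemma momentFun_mul_momentFun {k l : ℕ} {v w r : Finset (Fin p)} {x y t : Fin p → ℝ}
    (h : ∀ a : Fin p → ℝ, (∀ j ∈ r, a j ≤ t j) ↔ (∀ j ∈ v, a j ≤ x j) ∧ ∀ j ∈ w, a j ≤ y j) :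
    momentFun k v x * momentFun l w y = momentFun (k + l) r t := by
  funext z
  have := h z.2
  simp only [Pi.mul_apply, momentFun, Set.indicator_apply, Set.mem_ofPred_eq, Pi.le_def,
    Finset.restrict_def, Subtype.forall, Pi.one_apply]
  simp only [this, pow_add]
  split_ifs <;> first | ring1 | tauto

lemma moment_eq_integral_momentFun_mul {S : Type*} [MeasurableSpace S] {P : Measure S}
    {Y : S → ℝ} {X : S → Fin p → ℝ} (hYX : AEMeasurable (fun s => (Y s, X s)) P) {k l m : ℕ}
    (hm : m = k + l) {v w r : Finset (Fin p)} {x y t : Fin p → ℝ}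
    (h : ∀ a : Fin p → ℝ, (∀ j ∈ r, a j ≤ t j) ↔ (∀ j ∈ v, a j ≤ x j) ∧ ∀ j ∈ w, a j ≤ y j) :
    moment P Y X m r t =
      ∫ z, (momentFun k v x * momentFun l w y) z ∂(P.map fun s => (Y s, X s)) := by
  rw [momentFun_mul_momentFun h, ← hm, moment_eq_integral_momentFun hYX]

/-- The integrands of the components of `eta`. -/
noncomputable def etaFun (u : Finset (Fin p)) (x : Fin p → ℝ) :
    Fin 3 → ℝ × (Fin p → ℝ) → ℝ :=
  ![momentFun 1 Finset.univ x, momentFun 1 u x, momentFun 0 uᶜ x]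

lemma measurable_etaFun (u : Finset (Fin p)) (x : Fin p → ℝ) (a : Fin 3) :
    Measurable (etaFun u x a) := by
  fin_cases a <;> exact measurable_momentFun _ _ _

lemma memLp_etaFun {μ : Measure (ℝ × (Fin p → ℝ))} [IsProbabilityMeasure μ]
    (hμ : MemLp Prod.fst 2 μ) (u : Finset (Fin p)) (x : Fin p → ℝ) (a : Fin 3) :
    MemLp (etaFun u x a) 2 μ := by
  fin_cases a <;> exact memLp_momentFun hμ (by norm_num) _ _

lemma eta_eq_integral_etaFun {S : Type*} [MeasurableSpace S] {P : Measure S} {Y : S → ℝ}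
    {X : S → Fin p → ℝ} (hYX : AEMeasurable (fun s => (Y s, X s)) P) (u : Finset (Fin p))
    (x : Fin p → ℝ) (a : Fin 3) :
    eta P Y X u x a = ∫ z, etaFun u x a z ∂(P.map fun s => (Y s, X s)) := by
  fin_cases a <;> exact moment_eq_integral_momentFun hYX _ _ _

lemma empEta_eq_sum_etaFun {S : Type*} (Y : ℕ → S → ℝ) (X : ℕ → S → Fin p → ℝ)
    (u : Finset (Fin p)) (n : ℕ) (x : Fin p → ℝ) (s : S) (a : Fin 3) :
    empEta Y X u n x s a =
      (1 / (n : ℝ)) * ∑ i ∈ Finset.range n, etaFun u x a (Y i s, X i s) := by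
  fin_cases a <;> rfl

lemma sqrt_smul_empEta_sub_eta {S S₀ : Type*} [MeasurableSpace S₀] {P₀ : Measure S₀}
    {Y₀ : S₀ → ℝ} {X₀ : S₀ → Fin p → ℝ} (hYX : AEMeasurable (fun s => (Y₀ s, X₀ s)) P₀)
    (Y : ℕ → S → ℝ) (X : ℕ → S → Fin p → ℝ) (u : Finset (Fin p)) (n : ℕ) (x : Fin p → ℝ)
    (s : S) (a : Fin 3) :
    (√(n : ℝ) • (empEta Y X u n x s - eta P₀ Y₀ X₀ u x)) a =
      (√(n : ℝ))⁻¹ * (∑ i ∈ Finset.range n, etaFun u x a (Y i s, X i s) -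
        n * ∫ z, etaFun u x a z ∂(P₀.map fun s => (Y₀ s, X₀ s))) := by
  rw [Pi.smul_apply, Pi.sub_apply, empEta_eq_sum_etaFun, eta_eq_integral_etaFun hYX, smul_eq_mul]
  rcases Nat.eq_zero_or_pos n with rfl | hn
  -- For `n = 0` both sides vanish, as `√0 = 0` and `0⁻¹ = 0`.
  · simp
  · have hn' : (0 : ℝ) < n := by exact_mod_cast hn
    have hs : √(n : ℝ) ≠ 0 := (Real.sqrt_pos.2 hn').ne'
    have hsq : √(n : ℝ) ^ 2 = n := Real.sq_sqrt hn'.le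
    field_simp
    rw [hsq]

lemma forall_mem_univ_le_glue_iff (u : Finset (Fin p)) (s t a : Fin p → ℝ) :
    (∀ j ∈ Finset.univ, a j ≤ glue u s t j) ↔
      (∀ j ∈ u, a j ≤ s j) ∧ ∀ j ∈ uᶜ, a j ≤ t j := by
  simp only [Finset.mem_univ, true_implies, Finset.mem_compl, glue, ← forall_and]
  refine forall_congr' fun j => ?_
  by_cases hj : j ∈ u <;> simp [hj]

lemma autoCov_eq_covariance {S : Type*} [MeasurableSpace S] {P : Measure S}
    [IsProbabilityMeasure P] {Y : S → ℝ} {X : S → Fin p → ℝ}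
    (hYX : AEMeasurable (fun s => (Y s, X s)) P) (hY : MemLp Y 2 P)
    (u : Finset (Fin p)) (x x' : Fin p → ℝ) (a b : Fin 3) :
    autoCov P Y X u x x' a b =
      cov[etaFun u x a, etaFun u x' b; P.map fun s => (Y s, X s)] := by
  have hprob := Measure.isProbabilityMeasure_map hYX
  have hμ : MemLp Prod.fst 2 (P.map fun s => (Y s, X s)) :=
    (memLp_map_measure_iff measurable_fst.aestronglyMeasurable hYX).2 hY
  rw [covariance_eq_sub (memLp_etaFun hμ u x a) (memLp_etaFun hμ u x' b),
    ← eta_eq_integral_etaFun hYX, ← eta_eq_integral_etaFun hYX, autoCov, Matrix.sub_apply,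
    Matrix.vecMulVec_apply]
  congr 1
  -- In each of the nine entries the two coordinatewise constraints combine into the threshold
  -- displayed in `autoCov`.
  fin_cases a <;> fin_cases b <;>
    refine moment_eq_integral_momentFun_mul hYX (by rfl) fun a => ?_ <;>
    (try simp only [forall_mem_univ_le_glue_iff]) <;>
    simp only [Finset.mem_univ, true_implies, Finset.mem_compl, Pi.inf_apply, le_inf_iff] <;>
    grind

end Features

end MomentField

/-! ### The limit theorem. -/

theorem proposition1 {p : ℕ} (u : Finset (Fin p))
    {S₀ : Type*} [MeasurableSpace S₀] (P₀ : Measure S₀) [IsProbabilityMeasure P₀]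
    (Y₀ : S₀ → ℝ) (X₀ : S₀ → Fin p → ℝ) (hY₀ : MemLp Y₀ 2 P₀)
    {S : Type*} [MeasurableSpace S] (P : Measure S) [IsProbabilityMeasure P]
    (Y : ℕ → S → ℝ) (X : ℕ → S → Fin p → ℝ)
    (hindep : iIndepFun (fun i s => (Y i s, X i s)) P)
    (hident : ∀ i, IdentDistrib (fun s => (Y i s, X i s)) (fun s => (Y₀ s, X₀ s)) P P₀) :
    ∃ (S' : Type) (_ : MeasurableSpace S') (P' : Measure S') (_ : IsProbabilityMeasure P')
      (G : (Fin p → ℝ) → S' → (Fin 3 → ℝ)),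
      IsGaussianProcess G P' ∧
      (∀ x a, ∫ s, G x s a ∂P' = 0) ∧
      (∀ x x' a b, cov[fun s => G x s a, fun s => G x' s b; P'] =
        MomentField.autoCov P₀ Y₀ X₀ u x x' a b) ∧
      MomentField.TendstoInFDD
        (fun n x s => √(n : ℝ) • (MomentField.empEta Y X u n x s - MomentField.eta P₀ Y₀ X₀ u x))
        G P P' := by
  have hYX : AEMeasurable (fun s => (Y₀ s, X₀ s)) P₀ := (hident 0).aemeasurable_snd
  have hprob := Measure.isProbabilityMeasure_map hYX
  have hμ : MemLp Prod.fst 2 (P₀.map fun s => (Y₀ s, X₀ s)) :=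
    (memLp_map_measure_iff measurable_fst.aestronglyMeasurable hYX).2 hY₀
  obtain ⟨Ω, mΩ, P', hP', B, hBmem, hBcov, hBlaw⟩ :=
    MomentField.exists_gaussian_family (P₀.map fun s => (Y₀ s, X₀ s))
  have hmem := MomentField.memLp_etaFun hμ u
  have hBm (f) : AEMeasurable (B f) P' := (hBmem f).aestronglyMeasurable.aemeasurable
  refine ⟨Ω, mΩ, P', hP', fun x ω a => B (MomentField.etaFun u x a) ω, ⟨fun I => ?_⟩,
    fun x a => ?_, fun x x' a b => ?_, fun K t => ?_⟩
  · refine MomentField.hasGaussianLaw_pi_of_forall_sum ?_ fun c => ?_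
    · exact aemeasurable_pi_lambda _ fun i => aemeasurable_pi_lambda _ fun a => hBm _
    · exact (hBlaw (I × Fin 3) (fun k => MomentField.etaFun u k.1 k.2)
        (fun k => hmem _ _) c).hasGaussianLaw
  · have h := hBlaw Unit (fun _ => MomentField.etaFun u x a) (fun _ => hmem _ _) fun _ => 1
    have hint := h.integral_eq
    rw [integral_id_gaussianReal] at hint
    simpa using hint
  · rw [MomentField.autoCov_eq_covariance hYX hY₀, ← hBcov _ _ (hmem _ _) (hmem _ _)]
  -- Points and components are flattened into the index `Fin K × Fin 3`; currying, a continuous map,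
  -- restores the shape.
  · have h := MomentField.tendstoInDistribution_pi_inv_sqrt_mul_sum_sub hindep
      (fun i => ⟨(hident i).aemeasurable_fst, (hident i).map_eq⟩)
      (f := fun k : Fin K × Fin 3 => MomentField.etaFun u (t k.1) k.2)
      (fun k => MomentField.measurable_etaFun _ _ _) (fun k => hmem _ _)
      (G := fun ω k => B (MomentField.etaFun u (t k.1) k.2) ω) (P' := P') (by fun_prop)
      (hBlaw _ _ fun k => hmem _ _)
    convert! h.continuous_comp (g := fun (y : Fin K × Fin 3 → ℝ) k a => y (k, a))
      (by fun_prop) using 2 with n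
    funext s k a
    exact MomentField.sqrt_smul_empEta_sub_eta hYX Y X u n (t k) s a
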